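/- **Setting.** There are finitely many agents and finitely many goods; good $j$ comes in $k_j\ge 1$ indivisible copies. Agent $i$ has utility $u_{i,j,\ell}\ge 0$ for its $\ell$-th copy of good $j$, with $u_{i,j,1}\ge\dots\ge u_{i,j,k_j}$, and a utility cap $c_i$. An allocation $x$ hands out all copies; $m(j,x_i)$ is the number of copies of $j$ in the bundle $x_i$ of agent $i$, so $\sum_i m(j,x_i)=k_j$. Put $u_i(x_i)=\sum_j\sum_{\ell\le m(j,x_i)}u_{i,j,\ell}$ and $$\mathrm{NSW}(x)=\Bigl(\prod_{i}\min\bigl(c_i,u_i(x_i)\bigr)\Bigr)^{1/n},\qquad n=\text{number of agents}.$$ **Algorithm** (with parameter $\varepsilon\in(0,1/4]$, $r=1+\varepsilon$). The nonzero utilities and the caps are powers of $r$. Replace each $u_{i,j,\ell}$ by $\min(c_i,u_{i,j,\ell})$. For every good $j$, hand out its copies one by one, each to an agent $i$ maximizing the utility $u_{i,j,m(j,x_i)+1}$ of a further copy; let the price $p_j$ be the utility of the last copy for its recipient. Let all MBB-ratios be $\alpha_i=1$. Write $P_i(b)=u_i(b)/\alpha_i$ for a bundle $b$, and call agent $i$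 uncapped if $u_i(x_i)<c_i$. The tight graph has an edge $i\to j$ if $m(j,x_i)<k_j$ and $\alpha_i=u_{i,j,m(j,x_i)+1}/p_j$, and an edge $j\to i$ if $m(j,x_i)\ge1$ and $\alpha_i=u_{i,j,m(j,x_i)}/p_j$. Repeat the following. 1. If for every uncapped agent $i$ and every other agent $k$ with $x_k\neq\emptyset$ there is a good $j\in x_k$ with $P_k(x_k-j)\le(1+\varepsilon)P_i(x_i)$, return $x$. 2. Otherwise choose an uncapped agent $i$ with minimum $P_i(x_i)$. An improving path is a simple path $(i=a_0,g_1,a_1,\dots,g_h,a_h)$, $h\ge 1$, in the tight graph with $P_{a_h}(x_{a_h}-g_h)>(1+\varepsilon)P_i(x_i)$ and $P_{a_\ell}(x_{a_\ell}-g_\ell)\le(1+\varepsilon)P_i(x_i)$ for $1\le\ell<h$. If there is one, take a shortest one, set $\ell=h$ and, while $\ell>0$ and $P_{a_\ell}(x_{a_\ell}-g_\ell)>(1+\varepsilon)P_i(x_i)$, move one copy of $g_\ell$ from $a_\ell$ to $a_{\ell-1}$ and decrease $\ell$ by one. 3. If there is none, let $S$ be the set of agents and goods reachable from $i$ in the tight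 graph and let $$\beta_1=\min_{k\in S,\,j\notin S}\frac{\alpha_k}{u_{k,j,m(j,x_k)+1}/p_j},\quad \beta_2=\min_{k\notin S,\,j\in S}\frac{u_{k,j,m(j,x_k)}/p_j}{\alpha_k},\quad \beta_3=\frac{1}{r^2P_i(x_i)}\max_{k\notin S}\min_{j\in x_k}P_k(x_k-j),$$ where $\beta_1$ only involves pairs with $m(j,x_k)<k_j$, $\beta_2$ only pairs with $m(j,x_k)\ge1$, and in $\beta_3$ the inner minimum is $0$ if $x_k=\emptyset$. Let $\beta_4=r^s$ with $r^{s-1}\le P_h(x_h)/P_i(x_i)<r^s$, where $h\notin S$ is an uncapped agent of minimum $P_h(x_h)$ among those outside $S$ ($\beta_4=\infty$ if there is no such $h$, or if $P_i(x_i)=0$). A minimum over the empty set is $\infty$, a maximum over the empty set is $0$, and a quotient of a positive number by $0$ is $\infty$. Put $\beta=\min(\beta_1,\beta_2,\max(1,\beta_3),\beta_4)$, which is required to be finite, multiply the prices of the goods in $S$ by $\beta$ and divide the MBB-ratios of the agents in $S$ by $\beta$. If $\beta_3\le\min(\beta_1,\beta_2,\beta_4)$, return $x$. **Theorem.** Let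 $\varepsilon\in(0,1/4]$, $r=1+\varepsilon$ and $\gamma=4\varepsilon$. Consider an instance whose nonzero utilities and whose caps are powers of $r$ (with integer exponents). Let $x^{\mathrm{alg}}$ be the allocation returned by any terminating execution of the algorithm (ties and choices may be resolved arbitrarily), and let $x^*$ be an allocation maximizing Nash social welfare for this instance. Then $x^{\mathrm{alg}}$ is an allocation of all copies and $$\mathrm{NSW}(x^*)\le e^{e^{-1/(1+\gamma)}}\cdot\mathrm{NSW}(x^{\mathrm{alg}}).$$ Moreover, $e^{e^{-1/(1+4\varepsilon)}}\to e^{1/e}$ as $\varepsilon\to0^+$. -/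

import Mathlib

open Filter Topology
open scoped NNReal ENNReal

/-- A fair division problem with agents `A` and goods `G`. There are `copies j ≥ 1` indivisible
copies of good `j`; `utility i j ℓ` is the utility for agent `i` of its `ℓ`-th copy of good `j`
(meaningful for `1 ≤ ℓ ≤ copies j` only), it is non-increasing in `ℓ`; `cap i` is the utility cap
of agent `i`. -/
structure FairDivision (A G : Type*) where
  copies : G → ℕ
  copies_pos : ∀ j, 1 ≤ copies j
  utility : A → G → ℕ → ℝ≥0
  utility_anti : ∀ i j ℓ, 1 ≤ ℓ → ℓ < copies j → utility i j (ℓ + 1) ≤ utility i j ℓ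
  cap : A → ℝ≥0

/-- A state of the algorithm: `alloc i j` is the multiplicity of good `j` in the bundle of agent
`i`, `price j` is the price of good `j`, and `mbb i` is the MBB-ratio `αᵢ` of agent `i`. -/
structure MarketState (A G : Type*) where
  alloc : A → G → ℕ
  price : G → ℝ≥0
  mbb : A → ℝ≥0

section Bundles

variable {G : Type*} [DecidableEq G]

/-- The bundle `b - j`. -/
def removeItem (b : G → ℕ) (j : G) : G → ℕ := Function.update b j (b j - 1)

/-- The bundle `b + j`. -/
def addItem (b : G → ℕ) (j : G) : G → ℕ := Function.update b j (b j + 1)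

/-- Take one copy of good `j` away from agent `src` and assign it to agent `dst`. -/
def moveItem {A : Type*} [DecidableEq A] (x : A → G → ℕ) (j : G) (src dst : A) : A → G → ℕ :=
  fun i => if i = src then removeItem (x i) j else if i = dst then addItem (x i) j else x i

end Bundles

namespace FairDivision

noncomputable section

variable {A G : Type*} [Fintype A] [DecidableEq A] [Fintype G] [DecidableEq G]
variable (I : FairDivision A G)

/-- The non-zero utilities and the caps are (integral) powers of `r`. -/
def IsRounded (r : ℝ≥0) : Prop :=
  (∀ i j ℓ, 1 ≤ ℓ → ℓ ≤ I.copies j → I.utility i j ℓ ≠ 0 → ∃ z : ℤ, I.utility i j ℓ = r ^ z) ∧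
    ∀ i, ∃ z : ℤ, I.cap i = r ^ z

/-- An integral allocation: all copies of all goods are handed out. -/
def IsAllocation (x : A → G → ℕ) : Prop := ∀ j, ∑ i, x i j = I.copies j

/-- The (uncapped) utility of a bundle for agent `i`. -/
def bundleUtility (i : A) (b : G → ℕ) : ℝ≥0 := ∑ j, ∑ ℓ ∈ Finset.Icc 1 (b j), I.utility i j ℓ

/-- Nash social welfare: the geometric mean of the capped utilities. -/
def nsw (x : A → G → ℕ) : ℝ :=
  (∏ i, ((min (I.cap i) (I.bundleUtility i (x i)) : ℝ≥0) : ℝ)) ^ (1 / (Fintype.card A : ℝ))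

/-- `x` is an allocation maximizing Nash social welfare. -/
def IsOptimal (x : A → G → ℕ) : Prop :=
  I.IsAllocation x ∧ ∀ y, I.IsAllocation y → I.nsw y ≤ I.nsw x

/-! ### The algorithm -/

/-- Replace every utility `u i j ℓ` by `min (c i) (u i j ℓ)`. -/
def capUtilities : FairDivision A G where
  copies := I.copies
  copies_pos := I.copies_pos
  utility := fun i j ℓ => min (I.cap i) (I.utility i j ℓ)
  utility_anti := fun i j ℓ h h' => min_le_min le_rfl (I.utility_anti i j ℓ h h')
  cap := I.cap

/-- `I.Greedy j ℓ y q`: handing out the first `ℓ` copies of good `j` one after the other, each to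
some agent who values its next copy of `j` most (ties broken arbitrarily), can give the
multiplicities `y`, and `q` is the utility of the copy handed out last for its recipient. -/
inductive Greedy (j : G) : ℕ → (A → ℕ) → ℝ≥0 → Prop
  | zero : Greedy j 0 (fun _ => 0) 0
  | succ {ℓ : ℕ} {y : A → ℕ} {q : ℝ≥0} (i₀ : A) (hy : Greedy j ℓ y q)
      (hmax : ∀ i, I.utility i j (y i + 1) ≤ I.utility i₀ j (y i₀ + 1)) :
      Greedy j (ℓ + 1) (Function.update y i₀ (y i₀ + 1)) (I.utility i₀ j (y i₀ + 1))

/-- The possible states after the initialization. -/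
def IsInitial (s : MarketState A G) : Prop :=
  (∀ j, I.Greedy j (I.copies j) (fun i => s.alloc i j) (s.price j)) ∧ ∀ i, s.mbb i = 1

/-- The value `P_i(b)` of the bundle `b` for agent `i`, for given MBB-ratios. -/
def worth (α : A → ℝ≥0) (i : A) (b : G → ℕ) : ℝ≥0 := I.bundleUtility i b / α i

/-- Agent `i` is uncapped. -/
def Uncapped (s : MarketState A G) (i : A) : Prop := I.bundleUtility i (s.alloc i) < I.cap i

/-- Agent `i` `ε`-`p`-envies agent `k` up to one item: also after the removal of any one item, the
(non-empty) bundle of `k` has value more than `(1 + ε) P_i(x_i)`. -/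
def Envies (ε : ℝ≥0) (s : MarketState A G) (i k : A) : Prop :=
  (∃ j, 1 ≤ s.alloc k j) ∧ ∀ j, 1 ≤ s.alloc k j →
    (1 + ε) * I.worth s.mbb i (s.alloc i) < I.worth s.mbb k (removeItem (s.alloc k) j)

/-- The allocation is `ε`-`p`-envy free up to one item. -/
def IsPEF1 (ε : ℝ≥0) (s : MarketState A G) : Prop :=
  ∀ i, I.Uncapped s i → ∀ k, k ≠ i → ¬ I.Envies ε s i k

/-- Agent `i` has the property `Q` and has the least spending among the uncapped agents with this
property. -/
def IsLeastSpending (s : MarketState A G) (Q : A → Prop) (i : A) : Prop :=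
  Q i ∧ I.Uncapped s i ∧ ∀ k, Q k → I.Uncapped s k →
    I.worth s.mbb i (s.alloc i) ≤ I.worth s.mbb k (s.alloc k)

/-- Edge from agent `i` to good `j` in the tight graph: `αᵢ` is at its lower bound for `(i, j)`.
(The lower bound is zero, and never attained, if `i` owns all copies of `j`.) -/
def TightToGood (s : MarketState A G) (i : A) (j : G) : Prop :=
  s.alloc i j < I.copies j ∧ s.mbb i = I.utility i j (s.alloc i j + 1) / s.price j

/-- Edge from good `j` to agent `i` in the tight graph: `αᵢ` is at its upper bound for `(i, j)`.
(There is no upper bound if `i` owns no copy of `j`.) -/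
def TightToAgent (s : MarketState A G) (j : G) (i : A) : Prop :=
  1 ≤ s.alloc i j ∧ s.mbb i = I.utility i j (s.alloc i j) / s.price j

/-- The tight graph, with the agents on one side and the goods on the other. -/
def TightEdge (s : MarketState A G) : A ⊕ G → A ⊕ G → Prop
  | .inl i, .inr j => I.TightToGood s i j
  | .inr j, .inl i => I.TightToAgent s j i
  | _, _ => False

/-- The set of agents and goods that are reachable from agent `i` in the tight graph. -/
def reachable (s : MarketState A G) (i : A) : Set (A ⊕ G) :=
  {v | Relation.ReflTransGen (I.TightEdge s) (.inl i) v}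

/-- `(i = a 0, g 1, a 1, …, g h, a h)` is an improving path starting at `i`; only the values
`a 0, …, a h` and `g 1, …, g h` matter. -/
structure IsImprovingPath (ε : ℝ≥0) (s : MarketState A G) (i : A)
    (h : ℕ) (a : ℕ → A) (g : ℕ → G) : Prop where
  start : a 0 = i
  pos : 1 ≤ h
  tight_good : ∀ ℓ, ℓ < h → I.TightToGood s (a ℓ) (g (ℓ + 1))
  tight_agent : ∀ ℓ, ℓ < h → I.TightToAgent s (g (ℓ + 1)) (a (ℓ + 1))
  agents_distinct : Set.InjOn a (Set.Icc 0 h)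
  goods_distinct : Set.InjOn g (Set.Icc 1 h)
  last : (1 + ε) * I.worth s.mbb i (s.alloc i) <
    I.worth s.mbb (a h) (removeItem (s.alloc (a h)) (g h))
  inner : ∀ ℓ, 1 ≤ ℓ → ℓ < h → I.worth s.mbb (a ℓ) (removeItem (s.alloc (a ℓ)) (g ℓ)) ≤
    (1 + ε) * I.worth s.mbb i (s.alloc i)

/-- A shortest improving path starting at `i`. -/
def IsShortestImprovingPath (ε : ℝ≥0) (s : MarketState A G) (i : A)
    (h : ℕ) (a : ℕ → A) (g : ℕ → G) : Prop :=
  I.IsImprovingPath ε s i h a g ∧ ∀ h' a' g', I.IsImprovingPath ε s i h' a' g' → h ≤ h'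

/-- The sequence of swaps along a path, i.e., the loop "while `ℓ > 0` and
`P_{a ℓ}(x_{a ℓ} - g ℓ) > (1 + ε) P_i(x_i)`: move `g ℓ` from `a ℓ` to `a (ℓ - 1)`, decrease `ℓ`",
run from the value `ℓ` and the allocation `x`, which are its last two arguments. -/
def swaps (ε : ℝ≥0) (α : A → ℝ≥0) (i : A) (a : ℕ → A) (g : ℕ → G) :
    ℕ → (A → G → ℕ) → (A → G → ℕ)
  | 0, x => x
  | ℓ + 1, x =>
    if (1 + ε) * I.worth α i (x i) <
        I.worth α (a (ℓ + 1)) (removeItem (x (a (ℓ + 1))) (g (ℓ + 1))) then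
      swaps ε α i a g ℓ (moveItem x (g (ℓ + 1)) (a (ℓ + 1)) (a ℓ))
    else x

/-- The minimum of `P_k(x_k - j)` over the goods `j` in `x_k` (zero if `x_k` is empty). -/
def minAfterRemoval (s : MarketState A G) (k : A) : ℝ≥0 :=
  if h : (Finset.univ.filter fun j => 1 ≤ s.alloc k j).Nonempty then
    (Finset.univ.filter fun j => 1 ≤ s.alloc k j).inf' h
      fun j => I.worth s.mbb k (removeItem (s.alloc k) j)
  else 0

/-! The factors limiting a price increase, with values in `[0, ∞]`: the minimum of the empty set is
`∞`, and so is a quotient with positive numerator and zero denominator. -/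

/-- Adding a good to `S`. -/
def beta1 (s : MarketState A G) (S : Set (A ⊕ G)) : ℝ≥0∞ :=
  ⨅ (k : A) (j : G) (_ : .inl k ∈ S ∧ .inr j ∉ S ∧ s.alloc k j < I.copies j),
    (s.mbb k : ℝ≥0∞) / ((I.utility k j (s.alloc k j + 1) : ℝ≥0∞) / (s.price j : ℝ≥0∞))

/-- Adding an agent to `S`. -/
def beta2 (s : MarketState A G) (S : Set (A ⊕ G)) : ℝ≥0∞ :=
  ⨅ (k : A) (j : G) (_ : .inl k ∉ S ∧ .inr j ∈ S ∧ 1 ≤ s.alloc k j),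
    ((I.utility k j (s.alloc k j) : ℝ≥0∞) / (s.price j : ℝ≥0∞)) / (s.mbb k : ℝ≥0∞)

/-- Agent `i` becomes happy. -/
def beta3 (ε : ℝ≥0) (s : MarketState A G) (i : A) (S : Set (A ⊕ G)) : ℝ≥0∞ :=
  1 / ((((1 + ε) ^ 2 * I.worth s.mbb i (s.alloc i) : ℝ≥0)) : ℝ≥0∞) *
    ⨆ (k : A) (_ : .inl k ∉ S), (I.minAfterRemoval s k : ℝ≥0∞)

/-- A new least spender appears: the power `r ^ t` with `r ^ (t - 1) ≤ P_h(x_h) / P_i(x_i) < r ^ t`,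
where `h` is a least spending uncapped agent outside `S` (and `∞` if there is no such `h` or `t`;
the inequalities are multiplied by `P_i(x_i)`). -/
def beta4 (ε : ℝ≥0) (s : MarketState A G) (i : A) (S : Set (A ⊕ G)) : ℝ≥0∞ :=
  ⨅ (h : A) (t : ℤ) (_ : I.IsLeastSpending s (fun k => .inl k ∉ S) h ∧
      (1 + ε) ^ (t - 1) * I.worth s.mbb i (s.alloc i) ≤ I.worth s.mbb h (s.alloc h) ∧
      I.worth s.mbb h (s.alloc h) < (1 + ε) ^ t * I.worth s.mbb i (s.alloc i)),
    (((1 + ε) ^ t : ℝ≥0) : ℝ≥0∞)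

/-- The factor `min (β₁, β₂, max (1, β₃), β₄)`. -/
def beta (ε : ℝ≥0) (s : MarketState A G) (i : A) (S : Set (A ⊕ G)) : ℝ≥0∞ :=
  min (min (I.beta1 s S) (I.beta2 s S)) (min (max 1 (I.beta3 ε s i S)) (I.beta4 ε s i S))

/-- The test for leaving the loop after a price increase. -/
def BreakTest (ε : ℝ≥0) (s : MarketState A G) (i : A) (S : Set (A ⊕ G)) : Prop :=
  I.beta3 ε s i S ≤ min (min (I.beta1 s S) (I.beta2 s S)) (I.beta4 ε s i S)

open Classical in
/-- Multiply the prices of the goods in `S` and divide the MBB-ratios of the agents in `S` by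
`b`. -/
def raisePrices (s : MarketState A G) (S : Set (A ⊕ G)) (b : ℝ≥0) : MarketState A G where
  alloc := s.alloc
  price := fun j => if .inr j ∈ S then s.price j * b else s.price j
  mbb := fun k => if .inl k ∈ S then s.mbb k / b else s.mbb k

/-- The else-branch of the loop body leads from `s` to `s'`; `i` is the chosen least spending
uncapped agent. -/
def PriceIncrease (ε : ℝ≥0) (s : MarketState A G) (i : A) (s' : MarketState A G) : Prop :=
  ¬ I.IsPEF1 ε s ∧ I.IsLeastSpending s (fun _ => True) i ∧
    (¬ ∃ h a g, I.IsImprovingPath ε s i h a g) ∧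
    I.beta ε s i (I.reachable s i) ≠ ∞ ∧
    s' = raisePrices s (I.reachable s i) (I.beta ε s i (I.reachable s i)).toNNReal

/-- One iteration of the main loop that does not leave the loop leads from `s` to `s'`. -/
inductive Step (ε : ℝ≥0) (s : MarketState A G) : MarketState A G → Prop
  | swap (i : A) (h : ℕ) (a : ℕ → A) (g : ℕ → G) (h_not : ¬ I.IsPEF1 ε s)
      (h_least : I.IsLeastSpending s (fun _ => True) i)
      (h_path : I.IsShortestImprovingPath ε s i h a g) :
      Step ε s ⟨I.swaps ε s.mbb i a g h s.alloc, s.price, s.mbb⟩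
  | increase (i : A) (s' : MarketState A G) (h_inc : I.PriceIncrease ε s i s')
      (h_continue : ¬ I.BreakTest ε s i (I.reachable s i)) :
      Step ε s s'

/-- An iteration of the main loop that starts in `s` leaves the loop in state `s'`. -/
inductive Halt (ε : ℝ≥0) (s : MarketState A G) : MarketState A G → Prop
  | done (h_done : I.IsPEF1 ε s) : Halt ε s s
  | increase (i : A) (s' : MarketState A G) (h_inc : I.PriceIncrease ε s i s')
      (h_break : I.BreakTest ε s i (I.reachable s i)) :
      Halt ε s s'

/-- On input `I` and `ε`, some execution of the algorithm (for some way of breaking ties and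
choosing paths) terminates and returns the allocation `x`. -/
def AlgorithmReturns (ε : ℝ≥0) (x : A → G → ℕ) : Prop :=
  ∃ s₀ s s' : MarketState A G, I.capUtilities.IsInitial s₀ ∧
    Relation.ReflTransGen (I.capUtilities.Step ε) s₀ s ∧
    I.capUtilities.Halt ε s s' ∧ s'.alloc = x

end

end FairDivision

set_option linter.unusedSectionVars false

/-! The algorithm keeps `α i * p j` between agent `i`'s utility for its next copy of `j` and for its
last one (`IsInvariant`). So prices separate copies held from copies not held: for every monotone
`F`, the current allocation maximizes the sum of `F (u / α i)` over all copies handed out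
(`IsInvariant.sum_potential_le`).

Let `P` be the least worth of an uncapped bundle and let no bundle exceed `(1 + γ) P` up to one
item. Put `w = exp (-1 / (1 + γ))`, measure worth in units of the water level `W = (1 + γ) P / w`,
and take `F = tangentLog`, a concave substitute for `1 + log` that stays finite at `0`. By
subadditivity the potential of a bundle dominates `tangentLog` of its value; up to one item it is at
most that value, hence at most `w` after normalization. Thus the log-gain of each agent is at most
its potential difference plus `w` (`log_min_sub_log_min_le`). Summed over the `n` agents the
potential differences are nonpositive, which leaves `n * w`, that is, a factor `exp w` in the
geometric mean (`IsInvariant.nsw_le`).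

It remains to see that the output is `4ε`-envy free up to one item (`Halt.isInvariant_and_isPEF1`):
a final price increase costs at most the factor `(1 + ε) ^ 3 ≤ 1 + 4ε`. -/

/-- The concave function that is the identity up to `1` and continues as `1 + log t`. -/
noncomputable def tangentLog (t : ℝ) : ℝ := min 1 t + Real.log (max 1 t)

/-! ### Concavity of `tangentLog` and the one-agent inequality. -/

section TangentLog

variable {s t : ℝ}

lemma tangentLog_of_le_one (h : t ≤ 1) : tangentLog t = t := by simp [tangentLog, h]

lemma tangentLog_of_one_le (h : 1 ≤ t) : tangentLog t = 1 + Real.log t := by simp [tangentLog, h]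

lemma tangentLog_mono : Monotone tangentLog := by
  intro s t h
  have h1 : (0 : ℝ) < max 1 s := lt_max_of_lt_left one_pos
  unfold tangentLog
  gcongr

lemma tangentLog_le_self (t : ℝ) : tangentLog t ≤ t := by
  rcases le_total t 1 with h1 | h1
  · rw [tangentLog_of_le_one h1]
  · rw [tangentLog_of_one_le h1]
    linarith [Real.log_le_sub_one_of_pos (one_pos.trans_le h1)]

lemma one_add_log_le_tangentLog (h : 0 < t) : 1 + Real.log t ≤ tangentLog t := by
  rcases le_total t 1 with h1 | h1
  · rw [tangentLog_of_le_one h1]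
    linarith [Real.log_le_sub_one_of_pos h]
  · rw [tangentLog_of_one_le h1]

/-- On `(0, 1]` the slope `1 / t` of `log` is at least the slope `1` of `tangentLog`; beyond `1` the
slopes agree. -/
lemma log_sub_log_le_tangentLog_sub (hs : 0 < s) (hst : s ≤ t) :
    Real.log s - Real.log t ≤ tangentLog s - tangentLog t := by
  rcases le_total t 1 with h1 | h1
  · rw [tangentLog_of_le_one h1, tangentLog_of_le_one (hst.trans h1)]
    have ht : 0 < t := hs.trans_le hst
    rw [← Real.log_div hs.ne' ht.ne']
    have h2 := Real.log_le_sub_one_of_pos (div_pos hs ht)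
    have h3 : s / t - 1 ≤ s - t := by
      rw [div_sub_one ht.ne', div_le_iff₀ ht]
      nlinarith
    linarith
  · rw [tangentLog_of_one_le h1]
    linarith [one_add_log_le_tangentLog hs]

/-- Concavity together with value `0` at `0` makes `tangentLog t / t` non-increasing, which gives
subadditivity. -/
lemma mul_tangentLog_le (hs : 0 ≤ s) (hst : s ≤ t) : s * tangentLog t ≤ t * tangentLog s := by
  rcases hs.eq_or_lt with rfl | hs
  · simp [tangentLog_of_le_one]
  rcases le_total s 1 with h1 | h1
  · rw [tangentLog_of_le_one h1, mul_comm t]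
    exact mul_le_mul_of_nonneg_left (tangentLog_le_self t) hs.le
  · have ht : 0 < t := hs.trans_le hst
    rw [tangentLog_of_one_le h1, tangentLog_of_one_le (h1.trans hst)]
    have h2 := Real.log_le_sub_one_of_pos (div_pos ht hs)
    rw [Real.log_div ht.ne' hs.ne'] at h2
    have h3 : s * (Real.log t - Real.log s) ≤ t - s := by
      calc s * (Real.log t - Real.log s) ≤ s * (t / s - 1) := by gcongr
        _ = t - s := by field_simp
    have h4 := mul_nonneg (sub_nonneg.2 hst) (Real.log_nonneg h1)
    linarith

lemma tangentLog_add_le (hs : 0 ≤ s) (ht : 0 ≤ t) :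
    tangentLog (s + t) ≤ tangentLog s + tangentLog t := by
  rcases (add_nonneg hs ht).eq_or_lt with h | h
  · obtain rfl : s = 0 := by linarith
    simp [tangentLog]
  · have h1 := mul_tangentLog_le hs (le_add_of_nonneg_right ht)
    have h2 := mul_tangentLog_le ht (le_add_of_nonneg_left hs)
    refine le_of_mul_le_mul_left ?_ h
    linarith

lemma tangentLog_sum_le {ι : Type*} (S : Finset ι) (f : ι → ℝ) (hf : ∀ i ∈ S, 0 ≤ f i) :
    tangentLog (∑ i ∈ S, f i) ≤ ∑ i ∈ S, tangentLog (f i) :=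
  Finset.le_sum_of_subadditive_on_pred tangentLog (fun t => 0 ≤ t) (by simp [tangentLog])
    (fun _ _ => tangentLog_add_le) (fun _ _ => add_nonneg) f hf

/-- In units of the water level: the gain of one agent with cap `c` whose bundle value changes from
`V` to `Y`, in terms of the potentials `ΦV` and `ΦY` of its two bundles. -/
lemma log_min_sub_log_min_le {c Y V v w δ ΦY ΦV : ℝ} (hc : 0 < c) (hY : 0 < Y)
    (hΦY : tangentLog Y ≤ ΦY) (hΦv : ΦV ≤ tangentLog v + w) (hΦV : ΦV ≤ V)
    (hvV : v ≤ V) (hvc : v ≤ c) (hδ : 0 < δ) (hδV : V < c → δ ≤ V)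
    (hδw : δ - 1 - Real.log δ ≤ w) :
    Real.log (min c Y) - Real.log (min c V) ≤ ΦY - ΦV + w := by
  have hm : 0 < min c Y := lt_min hc hY
  -- If the cap is reached, compare `min c Y` with `c` and use that the single removed item `v` is
  -- itself at most `c`. Otherwise the value `V` is at least `δ`.
  rcases le_or_gt c V with h | h
  · rw [min_eq_left h]
    have h1 := log_sub_log_le_tangentLog_sub hm (min_le_left c Y)
    have h2 := tangentLog_mono (min_le_right c Y)
    have h3 := tangentLog_mono hvc
    linarith
  · rw [min_eq_right h.le]
    have hV := hδ.trans_le (hδV h)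
    have h1 : Real.log (min c Y) ≤ Real.log Y := Real.log_le_log hm (min_le_right c Y)
    have h2 := one_add_log_le_tangentLog hY
    rcases le_total 1 V with h3 | h3
    · have h4 := tangentLog_of_one_le h3
      have h5 := tangentLog_mono hvV
      linarith
    · have h4 := log_sub_log_le_tangentLog_sub hδ (hδV h)
      rw [tangentLog_of_le_one h3, tangentLog_of_le_one ((hδV h).trans h3)] at h4
      linarith

end TangentLog

/-! ### The numerical inequality that fixes the approximation constant. -/

/-- This is `x ≤ sinh x` at `x = log (1 + γ)`. -/
lemma log_one_add_le {γ : ℝ} (h : 0 ≤ γ) : Real.log (1 + γ) ≤ γ * (2 + γ) / (2 * (1 + γ)) := by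
  have h1 : Real.log (1 + γ) ≤ Real.sinh (Real.log (1 + γ)) :=
    Real.self_le_sinh_iff.2 (Real.log_nonneg (by linarith))
  rw [Real.sinh_log (by linarith)] at h1
  convert h1 using 1
  field_simp
  ring

/-- Here `w / (1 + γ)` is the least spending in units of the water level. The claim reduces to `log
(1 + γ) ≤ γ (1 + w) / (1 + γ)`, which follows from `γ / 2 ≤ w`; at `γ = 0` there is equality. -/
lemma exp_div_sub_one_sub_log_le {γ : ℝ} (h : 0 ≤ γ) (h1 : γ ≤ 1) :
    Real.exp (-1 / (1 + γ)) / (1 + γ) - 1 - Real.log (Real.exp (-1 / (1 + γ)) / (1 + γ)) ≤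
      Real.exp (-1 / (1 + γ)) := by
  have h0 : 0 < 1 + γ := by linarith
  rw [Real.log_div (Real.exp_pos _).ne' h0.ne', Real.log_exp]
  have h2 := log_one_add_le h
  have h3 : γ / 2 ≤ Real.exp (-1 / (1 + γ)) := by
    refine le_trans ?_ (Real.add_one_le_exp _)
    rw [div_add_one h0.ne', div_le_div_iff₀ two_pos h0]
    nlinarith
  generalize Real.exp (-1 / (1 + γ)) = w at h3 ⊢
  have h4 : γ * (2 + γ) / (2 * (1 + γ)) = γ * (1 + γ / 2) / (1 + γ) := by
    field_simp
  have h5 : γ * (1 + γ / 2) / (1 + γ) ≤ γ * (1 + w) / (1 + γ) := by gcongr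
  have h6 : w / (1 + γ) - 1 - (-1 / (1 + γ)) + γ * (1 + w) / (1 + γ) = w := by
    field_simp
    ring
  linarith

/-! ### The invariant, and optimality of the allocation for separable potentials. -/

namespace FairDivision

variable {A G : Type*} [Fintype A] [DecidableEq A] [Fintype G] [DecidableEq G]
variable {I : FairDivision A G}

/-- The invariant of the algorithm: the allocation is complete and all MBB-ratios are positive and
lie between their lower and their upper bounds. -/
structure IsInvariant (I : FairDivision A G) (s : MarketState A G) : Prop where
  mbb_pos : ∀ i, 0 < s.mbb i
  isAllocation : I.IsAllocation s.alloc
  utility_succ_le : ∀ i j, s.alloc i j < I.copies j →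
    I.utility i j (s.alloc i j + 1) ≤ s.mbb i * s.price j
  le_utility : ∀ i j, 1 ≤ s.alloc i j → s.mbb i * s.price j ≤ I.utility i j (s.alloc i j)

lemma IsAllocation.le_copies {x : A → G → ℕ} (hx : I.IsAllocation x) (i : A) (j : G) :
    x i j ≤ I.copies j := by
  rw [← hx j]
  exact Finset.single_le_sum (f := fun i => x i j) (fun _ _ => Nat.zero_le _) (Finset.mem_univ i)

lemma utility_le_of_le (I : FairDivision A G) (i : A) (j : G) {m n : ℕ} (hm : 1 ≤ m) (hmn : m ≤ n)
    (hn : n ≤ I.copies j) : I.utility i j n ≤ I.utility i j m := by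
  induction n, hmn using Nat.le_induction with
  | base => exact le_rfl
  | succ n hmn ih => exact (I.utility_anti i j n (hm.trans hmn) hn).trans (ih (by omega))

end FairDivision

/-- Each copy gained counts at most `c` and each copy lost at least `c`. -/
lemma sum_Icc_sub_sum_Icc_le (f : ℕ → ℝ) (c : ℝ) (m n : ℕ)
    (h : ∀ ℓ, m < ℓ → ℓ ≤ n → f ℓ ≤ c) (h' : ∀ ℓ, 1 ≤ ℓ → n < ℓ → ℓ ≤ m → c ≤ f ℓ) :
    ∑ ℓ ∈ Finset.Icc 1 n, f ℓ - ∑ ℓ ∈ Finset.Icc 1 m, f ℓ ≤ ((n : ℝ) - m) * c := by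
  rcases le_total m n with hmn | hmn
  · clear h'
    induction n, hmn using Nat.le_induction with
    | base => simp
    | succ n hmn ih =>
      have h1 := ih fun ℓ hℓ hn => h ℓ hℓ (by omega)
      have h2 := h (n + 1) (by omega) le_rfl
      rw [Finset.sum_Icc_succ_top (by omega)]
      push_cast
      linarith
  · clear h
    induction m, hmn using Nat.le_induction with
    | base => simp
    | succ m hmn ih =>
      have h1 := ih fun ℓ hℓ hn hm => h' ℓ hℓ hn (by omega)
      have h2 := h' (m + 1) (by omega) (by omega) le_rfl
      rw [Finset.sum_Icc_succ_top (by omega)]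
      push_cast
      linarith

namespace FairDivision

variable {A G : Type*} [Fintype A] [DecidableEq A] [Fintype G] [DecidableEq G]
variable {I : FairDivision A G}

/-- The sum of `F (u i j ℓ)` over the copies in the bundle `b`. -/
noncomputable def potential (I : FairDivision A G) (i : A) (F : ℝ≥0 → ℝ) (b : G → ℕ) : ℝ :=
  ∑ j, ∑ ℓ ∈ Finset.Icc 1 (b j), F (I.utility i j ℓ)

/-- For good `j` the threshold `F (price j)` serves all agents at once, and the net changes in
multiplicity cancel because both allocations hand out all copies. -/
lemma IsInvariant.sum_potential_le {s : MarketState A G} (hs : I.IsInvariant s) {F : ℝ≥0 → ℝ}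
    (hF : Monotone F) {y : A → G → ℕ} (hy : I.IsAllocation y) :
    ∑ i, I.potential i (fun q => F (q / s.mbb i)) (y i) ≤
      ∑ i, I.potential i (fun q => F (q / s.mbb i)) (s.alloc i) := by
  unfold potential
  rw [Finset.sum_comm, Finset.sum_comm (f := fun i j => ∑ ℓ ∈ Finset.Icc 1 (s.alloc i j), _)]
  refine Finset.sum_le_sum fun j _ => ?_
  rw [← sub_nonpos, ← Finset.sum_sub_distrib]
  calc _ ≤ ∑ i, ((y i j : ℝ) - s.alloc i j) * F (s.price j) := by
        refine Finset.sum_le_sum fun i _ => sum_Icc_sub_sum_Icc_le _ _ _ _ ?_ ?_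
        · intro ℓ h1 h2
          have h3 := h2.trans (hy.le_copies i j)
          refine hF ?_
          rw [div_le_iff₀ (hs.mbb_pos i), mul_comm]
          exact (I.utility_le_of_le i j (by omega) h1 h3).trans
            (hs.utility_succ_le i j (by omega))
        · intro ℓ h1 _ h2
          refine hF ?_
          rw [le_div_iff₀ (hs.mbb_pos i), mul_comm]
          exact (hs.le_utility i j (h1.trans h2)).trans
            (I.utility_le_of_le i j h1 h2 (hs.isAllocation.le_copies i j))
    _ = 0 := by
        rw [← Finset.sum_mul, Finset.sum_sub_distrib]
        have h1 : ∑ i, (y i j : ℝ) = I.copies j := by exact_mod_cast hy j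
        have h2 : ∑ i, (s.alloc i j : ℝ) = I.copies j := by exact_mod_cast hs.isAllocation j
        rw [h1, h2, sub_self, zero_mul]

lemma potential_removeItem (i : A) (F : ℝ≥0 → ℝ) {b : G → ℕ} {j : G} (hj : 1 ≤ b j) :
    I.potential i F b = I.potential i F (removeItem b j) + F (I.utility i j (b j)) := by
  unfold potential
  rw [← Finset.add_sum_erase _ _ (Finset.mem_univ j),
    ← Finset.add_sum_erase (a := j) _ _ (Finset.mem_univ j)]
  have h1 : ∑ k ∈ Finset.univ.erase j, ∑ ℓ ∈ Finset.Icc 1 (removeItem b j k), F (I.utility i k ℓ) =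
      ∑ k ∈ Finset.univ.erase j, ∑ ℓ ∈ Finset.Icc 1 (b k), F (I.utility i k ℓ) := by
    refine Finset.sum_congr rfl fun k hk => ?_
    rw [removeItem, Function.update_of_ne (Finset.ne_of_mem_erase hk)]
  obtain ⟨m, hm⟩ : ∃ m, b j = m + 1 := ⟨b j - 1, by omega⟩
  rw [h1, removeItem, Function.update_self, hm, Nat.add_sub_cancel,
    Finset.sum_Icc_succ_top (by omega)]
  ring

lemma potential_coe (i : A) (b : G → ℕ) :
    I.potential i (fun q => (q : ℝ)) b = I.bundleUtility i b := by
  simp [potential, bundleUtility]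

lemma bundleUtility_removeItem_le (i : A) (b : G → ℕ) (j : G) :
    I.bundleUtility i (removeItem b j) ≤ I.bundleUtility i b := by
  unfold bundleUtility
  refine Finset.sum_le_sum fun k _ => Finset.sum_le_sum_of_subset ?_
  refine Finset.Icc_subset_Icc_right ?_
  unfold removeItem
  by_cases h : k = j
  · subst h; simp
  · simp [h]

lemma worth_removeItem_le (α : A → ℝ≥0) (i : A) (b : G → ℕ) (j : G) :
    I.worth α i (removeItem b j) ≤ I.worth α i b := by
  unfold worth
  gcongr
  exact I.bundleUtility_removeItem_le i b j

/-- If the bundle of some agent has value zero, and the other bundles have value zero up to one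
item, then in every allocation there is an agent with utility zero. -/
lemma IsInvariant.exists_bundleUtility_eq_zero {s : MarketState A G} (hs : I.IsInvariant s) {i : A}
    (hi : I.bundleUtility i (s.alloc i) = 0)
    (hk : ∀ k, k ≠ i → (∃ j, 1 ≤ s.alloc k j) →
      ∃ j, 1 ≤ s.alloc k j ∧ I.bundleUtility k (removeItem (s.alloc k) j) = 0)
    {y : A → G → ℕ} (hy : I.IsAllocation y) : ∃ k, I.bundleUtility k (y k) = 0 := by
  by_contra! hne
  classical
  -- This potential counts the copies of positive utility. The current allocation has none at `i`
  -- and at most one at each other agent, whereas `y` would need at least one at every agent.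
  let F : ℝ≥0 → ℝ := fun q => if q = 0 then 0 else 1
  have hF : Monotone F := by
    intro p q hpq
    by_cases hp : p = 0
    · simp only [F, hp, if_true]; split_ifs <;> norm_num
    · have : q ≠ 0 := fun h => hp (le_antisymm (h ▸ hpq) zero_le)
      simp [F, hp, this]
  have hF0 : ∀ q, 0 ≤ F q := fun q => by simp only [F]; split_ifs <;> norm_num
  have hF1 : ∀ q, F q ≤ 1 := fun q => by simp only [F]; split_ifs <;> norm_num
  have hzero : ∀ k b, I.bundleUtility k b = 0 →
      I.potential k (fun q => F (q / s.mbb k)) b = 0 := by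
    intro k b hb
    unfold bundleUtility at hb
    simp only [Finset.sum_eq_zero_iff] at hb
    refine Finset.sum_eq_zero fun j hj => Finset.sum_eq_zero fun ℓ hℓ => ?_
    simp [F, hb j hj ℓ hℓ]
  have h1 : ∀ k, 1 ≤ I.potential k (fun q => F (q / s.mbb k)) (y k) := by
    intro k
    obtain ⟨j, hj, h2⟩ := Finset.exists_ne_zero_of_sum_ne_zero (hne k)
    obtain ⟨ℓ, hℓ, h3⟩ := Finset.exists_ne_zero_of_sum_ne_zero h2
    have h4 : F (I.utility k j ℓ / s.mbb k) = 1 := by simp [F, h3, (hs.mbb_pos k).ne']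
    rw [← h4]
    refine le_trans ?_ (Finset.single_le_sum (fun j _ => Finset.sum_nonneg fun ℓ _ => hF0 _) hj)
    exact Finset.single_le_sum (f := fun ℓ => F (I.utility k j ℓ / s.mbb k))
      (fun ℓ _ => hF0 _) hℓ
  have h2 : ∀ k, k ≠ i → I.potential k (fun q => F (q / s.mbb k)) (s.alloc k) ≤ 1 := by
    intro k hki
    by_cases hex : ∃ j, 1 ≤ s.alloc k j
    · obtain ⟨j, hj, h3⟩ := hk k hki hex
      rw [potential_removeItem k _ hj, hzero k _ h3, zero_add]
      exact hF1 _
    · push Not at hex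
      have h3 : I.bundleUtility k (s.alloc k) = 0 := by
        refine Finset.sum_eq_zero fun j _ => ?_
        rw [Finset.Icc_eq_empty (by have := hex j; omega), Finset.sum_empty]
      rw [hzero k _ h3]
      exact zero_le_one
  have h3 := hs.sum_potential_le hF hy
  have h4 : ∑ k, I.potential k (fun q => F (q / s.mbb k)) (s.alloc k) <
      ∑ k, I.potential k (fun q => F (q / s.mbb k)) (y k) := by
    refine Finset.sum_lt_sum (fun k _ => ?_) ⟨i, Finset.mem_univ i, ?_⟩
    · by_cases hki : k = i
      · subst hki
        rw [hzero k _ hi]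
        exact zero_le_one.trans (h1 k)
      · exact (h2 k hki).trans (h1 k)
    · rw [hzero i _ hi]
      exact zero_lt_one.trans_le (h1 i)
  exact absurd h3 (not_le.2 h4)

lemma tangentLog_bundleUtility_le (i : A) (b : G → ℕ) {D : ℝ} (hD : 0 ≤ D) :
    tangentLog (I.bundleUtility i b / D) ≤ I.potential i (fun q => tangentLog (q / D)) b := by
  rw [← potential_coe, potential, Finset.sum_div]
  refine (tangentLog_sum_le _ _ fun j _ => ?_).trans (Finset.sum_le_sum fun j _ => ?_)
  · positivity
  · rw [Finset.sum_div]
    exact tangentLog_sum_le _ _ fun ℓ _ => by positivity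

lemma potential_tangentLog_le (i : A) (b : G → ℕ) (D : ℝ) :
    I.potential i (fun q => tangentLog (q / D)) b ≤ I.bundleUtility i b / D := by
  rw [← potential_coe, potential, potential, Finset.sum_div]
  refine Finset.sum_le_sum fun j _ => ?_
  rw [Finset.sum_div]
  exact Finset.sum_le_sum fun ℓ _ => tangentLog_le_self _

lemma utility_le_bundleUtility (i : A) {b : G → ℕ} {j : G} (hj : 1 ≤ b j) :
    I.utility i j (b j) ≤ I.bundleUtility i b := by
  unfold bundleUtility
  refine le_trans ?_ (Finset.single_le_sum (f := fun j => ∑ ℓ ∈ Finset.Icc 1 (b j),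
    I.utility i j ℓ) (fun _ _ => zero_le) (Finset.mem_univ j))
  exact Finset.single_le_sum (f := fun ℓ => I.utility i j ℓ) (fun _ _ => zero_le)
    (Finset.mem_Icc.2 ⟨hj, le_rfl⟩)

lemma bundleUtility_eq_zero_of_empty (i : A) {b : G → ℕ} (hb : ¬ ∃ j, 1 ≤ b j) :
    I.bundleUtility i b = 0 := by
  push Not at hb
  refine Finset.sum_eq_zero fun j _ => ?_
  rw [Finset.Icc_eq_empty (by have := hb j; omega), Finset.sum_empty]

/-- The potential of a bundle whose value up to one item is at most `w` times the water level. -/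
lemma exists_potential_le {α : A → ℝ≥0} {k : A} (hα : 0 < α k) {b : G → ℕ} {W w : ℝ} (hW : 0 < W)
    (hcap : ∀ j ℓ, I.utility k j ℓ ≤ I.cap k)
    (hb : I.worth α k b ≤ w * W ∨ ∃ j, 1 ≤ b j ∧ I.worth α k (removeItem b j) ≤ w * W) :
    ∃ v : ℝ, v ≤ I.cap k / (α k * W) ∧ v ≤ I.bundleUtility k b / (α k * W) ∧
      I.potential k (fun q => tangentLog (q / (α k * W))) b ≤ tangentLog v + w := by
  have hα' : (0 : ℝ) < α k := hα
  have hworth : ∀ b', (I.worth α k b' : ℝ) ≤ w * W → I.bundleUtility k b' / (α k * W) ≤ w := by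
    intro b' hb'
    rw [worth, NNReal.coe_div, div_le_iff₀ hα'] at hb'
    rw [div_le_iff₀ (by positivity)]
    linarith
  -- If no item has to be removed, `v = 0` works; otherwise `v` is the normalized utility of the
  -- removed copy.
  rcases hb with hb | ⟨j, hj, hb⟩
  · refine ⟨0, by positivity, by positivity, ?_⟩
    have h1 := I.potential_tangentLog_le k b (α k * W)
    rw [tangentLog_of_le_one zero_le_one, zero_add]
    exact h1.trans (hworth _ hb)
  · refine ⟨I.utility k j (b j) / (α k * W), ?_, ?_, ?_⟩
    · gcongr
      exact hcap _ _
    · gcongr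
      exact utility_le_bundleUtility k hj
    · rw [potential_removeItem k _ hj]
      have h1 := I.potential_tangentLog_le k (removeItem b j) (α k * W)
      linarith [hworth _ hb]

/-! ### From envy-freeness to Nash social welfare. -/

lemma nsw_le_of_prod_le {C : ℝ} (hC : 1 ≤ C) {x y : A → G → ℕ}
    (h : ∏ i, ((min (I.cap i) (I.bundleUtility i (y i)) : ℝ≥0) : ℝ) ≤
      C ^ Fintype.card A * ∏ i, ((min (I.cap i) (I.bundleUtility i (x i)) : ℝ≥0) : ℝ)) :
    I.nsw y ≤ C * I.nsw x := by
  unfold nsw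
  -- Without agents both welfares equal `1`, which is where `1 ≤ C` is needed.
  rcases Nat.eq_zero_or_pos (Fintype.card A) with h0 | h0
  · simpa [h0] using hC
  · refine (Real.rpow_le_rpow (Finset.prod_nonneg fun _ _ => NNReal.coe_nonneg _) h
      (by positivity)).trans_eq ?_
    rw [Real.mul_rpow (by positivity) (Finset.prod_nonneg fun _ _ => NNReal.coe_nonneg _), one_div,
      Real.pow_rpow_inv_natCast (by positivity) h0.ne']

lemma exists_isLeastSpending (s : MarketState A G) (Q : A → Prop)
    (h : ∃ i, Q i ∧ I.Uncapped s i) : ∃ i, I.IsLeastSpending s Q i := by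
  classical
  obtain ⟨i, hi⟩ := h
  obtain ⟨k, hk, hmin⟩ := Finset.exists_min_image
    (Finset.univ.filter fun i => Q i ∧ I.Uncapped s i) (fun i => I.worth s.mbb i (s.alloc i))
    ⟨i, by simpa using hi⟩
  simp only [Finset.mem_filter, Finset.mem_univ, true_and] at hk hmin
  exact ⟨k, hk.1, hk.2, fun j hj hj' => hmin j ⟨hj, hj'⟩⟩

/-- The approximation guarantee of an allocation that is `γ`-`p`-envy free up to one item. -/
theorem IsInvariant.nsw_le {s : MarketState A G} (hs : I.IsInvariant s)
    (hcap : ∀ i j ℓ, I.utility i j ℓ ≤ I.cap i) (hpos : ∀ i, 0 < I.cap i) {γ : ℝ≥0} (hγ : γ ≤ 1)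
    (hef : I.IsPEF1 γ s) {y : A → G → ℕ} (hy : I.IsAllocation y) :
    I.nsw y ≤ Real.exp (Real.exp (-1 / (1 + (γ : ℝ)))) * I.nsw s.alloc := by
  set w := Real.exp (-1 / (1 + (γ : ℝ))) with hw
  have hw0 : 0 < w := Real.exp_pos _
  have hC : 1 ≤ Real.exp w := Real.one_le_exp hw0.le
  refine nsw_le_of_prod_le hC ?_
  have hnonneg : (0 : ℝ) ≤ Real.exp w ^ Fintype.card A *
      ∏ i, ((min (I.cap i) (I.bundleUtility i (s.alloc i)) : ℝ≥0) : ℝ) :=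
    mul_nonneg (by positivity) (Finset.prod_nonneg fun _ _ => NNReal.coe_nonneg _)
  -- If every agent has reached its cap, no allocation does better.
  by_cases hunc : ∃ i, I.Uncapped s i
  swap
  · push Not at hunc
    refine le_trans ?_ (le_mul_of_one_le_left
      (Finset.prod_nonneg fun _ _ => NNReal.coe_nonneg _) (one_le_pow₀ hC))
    refine Finset.prod_le_prod (fun _ _ => NNReal.coe_nonneg _) fun k _ => ?_
    have h1 : I.cap k ≤ I.bundleUtility k (s.alloc k) := not_lt.1 (hunc k)
    rw [min_eq_left h1]
    exact_mod_cast min_le_left _ _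
  obtain ⟨i, -, hi, hmin⟩ := I.exists_isLeastSpending s (fun _ => True) (by simpa using hunc)
  have hef' : ∀ k, k ≠ i → (∃ j, 1 ≤ s.alloc k j) → ∃ j, 1 ≤ s.alloc k j ∧
      I.worth s.mbb k (removeItem (s.alloc k) j) ≤ (1 + γ) * I.worth s.mbb i (s.alloc i) := by
    intro k hk hex
    by_contra! h
    exact hef i hi k hk ⟨hex, h⟩
  by_cases hyz : ∃ k, I.bundleUtility k (y k) = 0
  · obtain ⟨k, hk⟩ := hyz
    rw [Finset.prod_eq_zero (Finset.mem_univ k) (by simp [hk])]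
    exact hnonneg
  -- A least spending of zero would force a zero factor in the product for `y`, a case already
  -- settled.
  have hi0 : 0 < I.worth s.mbb i (s.alloc i) := by
    by_contra! h
    have h0 : I.worth s.mbb i (s.alloc i) = 0 := le_antisymm h zero_le
    refine hyz (hs.exists_bundleUtility_eq_zero (i := i) ?_ ?_ hy)
    · simpa [worth, (hs.mbb_pos i).ne'] using h0
    · intro k hk hex
      obtain ⟨j, hj, h1⟩ := hef' k hk hex
      rw [h0, mul_zero] at h1
      exact ⟨j, hj, by simpa [worth, (hs.mbb_pos k).ne'] using h1⟩
  push Not at hyz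
  set P : ℝ := (I.worth s.mbb i (s.alloc i) : ℝ) with hP
  have hP0 : 0 < P := hi0
  have hγ0 : (0 : ℝ) ≤ γ := γ.coe_nonneg
  -- With this level the envy bound `(1 + γ) P` becomes `w` and the least spending `P` becomes `w /
  -- (1 + γ)`.
  set W : ℝ := (1 + γ) / w * P with hWdef
  have hW : 0 < W := by positivity
  have hwW : w * W = (1 + γ) * P := by rw [hWdef]; field_simp
  have hPW : P = w / (1 + γ) * W := by rw [hWdef]; field_simp
  have hapos : ∀ k, (0 : ℝ) < (min (I.cap k) (I.bundleUtility k (s.alloc k)) : ℝ≥0) := by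
    intro k
    refine NNReal.coe_pos.2 (lt_min (hpos k) ?_)
    by_contra! h
    have h0 : I.bundleUtility k (s.alloc k) = 0 := le_antisymm h zero_le
    have h1 := hmin k trivial (by unfold Uncapped; rw [h0]; exact hpos k)
    rw [worth, worth, h0, zero_div] at h1
    exact absurd h1 (not_le.2 hi0)
  have hypos : ∀ k, (0 : ℝ) < (min (I.cap k) (I.bundleUtility k (y k)) : ℝ≥0) := fun k =>
    NNReal.coe_pos.2 (lt_min (hpos k) (pos_iff_ne_zero.2 (hyz k)))
  have hagent : ∀ k,
      Real.log ((min (I.cap k) (I.bundleUtility k (y k)) : ℝ≥0) : ℝ) -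
        Real.log ((min (I.cap k) (I.bundleUtility k (s.alloc k)) : ℝ≥0) : ℝ) ≤
      I.potential k (fun q => tangentLog ((q / s.mbb k : ℝ≥0) / W)) (y k) -
        I.potential k (fun q => tangentLog ((q / s.mbb k : ℝ≥0) / W)) (s.alloc k) + w := by
    intro k
    have hα : (0 : ℝ) < s.mbb k := hs.mbb_pos k
    have hD : 0 < s.mbb k * W := by positivity
    have hfun : (fun q : ℝ≥0 => tangentLog ((q / s.mbb k : ℝ≥0) / W)) =
        fun q : ℝ≥0 => tangentLog (q / (s.mbb k * W)) := by
      funext q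
      rw [NNReal.coe_div, div_div]
    rw [hfun]
    have hval : I.worth s.mbb k (s.alloc k) ≤ w * W ∨ ∃ j, 1 ≤ s.alloc k j ∧
        I.worth s.mbb k (removeItem (s.alloc k) j) ≤ w * W := by
      rw [hwW]
      by_cases hk : k = i
      · subst hk
        exact Or.inl (le_mul_of_one_le_left hP0.le (by linarith))
      by_cases hex : ∃ j, 1 ≤ s.alloc k j
      · obtain ⟨j, hj, h⟩ := hef' k hk hex
        exact Or.inr ⟨j, hj, by exact_mod_cast h⟩
      · left
        rw [worth, bundleUtility_eq_zero_of_empty k hex, zero_div]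
        positivity
    obtain ⟨v, hv1, hv2, hv3⟩ := I.exists_potential_le (hs.mbb_pos k) hW (hcap k) hval
    have hc : (0 : ℝ) < I.cap k := hpos k
    have hY : (0 : ℝ) < I.bundleUtility k (y k) := NNReal.coe_pos.2 (pos_iff_ne_zero.2 (hyz k))
    have h := log_min_sub_log_min_le (c := I.cap k / (s.mbb k * W)) (δ := w / (1 + γ))
      (by positivity) (div_pos hY hD) (I.tangentLog_bundleUtility_le k (y k) hD.le) hv3
      (I.potential_tangentLog_le k (s.alloc k) _) hv2 hv1 (by positivity) ?_
      (exp_div_sub_one_sub_log_le hγ0 (by exact_mod_cast hγ))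
    -- Dividing by `α k * W` shifts both logarithms equally, so the normalization disappears from
    -- the difference.
    · refine le_trans (le_of_eq ?_) h
      have hV := hapos k
      have hV' := hypos k
      rw [NNReal.coe_min] at hV hV' ⊢
      rw [NNReal.coe_min, min_div_div_right hD.le, min_div_div_right hD.le,
        Real.log_div hV'.ne' hD.ne', Real.log_div hV.ne' hD.ne']
      ring
    · intro hlt
      rw [div_lt_div_iff_of_pos_right hD] at hlt
      have h1 := hmin k trivial (by exact_mod_cast hlt)
      have h2 : P ≤ I.worth s.mbb k (s.alloc k) := by exact_mod_cast h1
      rw [worth, NNReal.coe_div, le_div_iff₀ hα, hPW] at h2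
      rw [le_div_iff₀ hD]
      linarith
  have hex := hs.sum_potential_le (F := fun q => tangentLog (q / W))
    (fun p q hpq => tangentLog_mono (by gcongr)) hy
  rw [← Real.log_le_log_iff (Finset.prod_pos fun k _ => hypos k)
    (mul_pos (by positivity) (Finset.prod_pos fun k _ => hapos k)),
    Real.log_mul (by positivity) (Finset.prod_pos fun k _ => hapos k).ne', Real.log_pow,
    Real.log_exp, Real.log_prod fun k _ => (hypos k).ne', Real.log_prod fun k _ => (hapos k).ne']
  have h1 := Finset.sum_le_sum fun k (_ : k ∈ Finset.univ) => hagent k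
  simp only [Finset.sum_add_distrib, Finset.sum_sub_distrib, Finset.sum_const, Finset.card_univ,
    nsmul_eq_mul] at h1
  linarith

/-! ### The initial allocation -/

lemma Greedy.bounds {j : G} {ℓ : ℕ} {y : A → ℕ} {q : ℝ≥0} (h : I.Greedy j ℓ y q)
    (hℓ : ℓ ≤ I.copies j) : ∑ i, y i = ℓ ∧
      (1 ≤ ℓ → ∀ i, y i < I.copies j → I.utility i j (y i + 1) ≤ q) ∧
      ∀ i, 1 ≤ y i → q ≤ I.utility i j (y i) := by
  induction h with
  | zero => simp
  | @succ ℓ y q i₀ hy hmax ih =>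
    obtain ⟨hsum, hlow, hup⟩ := ih (by omega)
    have hle : ∀ i, y i ≤ ℓ := fun i => by
      rw [← hsum]
      exact Finset.single_le_sum (f := y) (fun _ _ => Nat.zero_le _) (Finset.mem_univ i)
    refine ⟨?_, fun _ i hi => ?_, fun i hi => ?_⟩
    · rw [Finset.sum_update_of_mem (Finset.mem_univ i₀), ← hsum,
        ← Finset.add_sum_erase _ y (Finset.mem_univ i₀), Finset.sdiff_singleton_eq_erase]
      ring
    · rcases eq_or_ne i i₀ with rfl | hne
      · rw [Function.update_self] at hi ⊢
        exact I.utility_anti i j _ (by omega) hi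
      · rw [Function.update_of_ne hne]
        exact hmax i
    · rcases eq_or_ne i i₀ with rfl | hne
      · rw [Function.update_self]
      · rw [Function.update_of_ne hne] at hi ⊢
        -- The greedy price never rises: the new recipient's next copy was worth at most the
        -- previous price, which bounds older holdings from below.
        exact (hlow (hi.trans (hle i)) i₀ (by have := hle i₀; omega)).trans (hup i hi)

lemma IsInitial.isInvariant {s : MarketState A G} (h : I.IsInitial s) : I.IsInvariant s where
  mbb_pos i := by rw [h.2 i]; exact one_pos
  isAllocation j := ((h.1 j).bounds le_rfl).1
  utility_succ_le i j hj := by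
    rw [h.2 i, one_mul]
    exact ((h.1 j).bounds le_rfl).2.1 (I.copies_pos j) i hj
  le_utility i j hj := by
    rw [h.2 i, one_mul]
    exact ((h.1 j).bounds le_rfl).2.2 i hj

/-! ### Swaps -/

lemma moveItem_of_ne (x : A → G → ℕ) {j j' : G} (src dst i : A) (h : j' ≠ j) :
    moveItem x j src dst i j' = x i j' := by
  unfold moveItem removeItem addItem
  split_ifs <;> simp [h]

lemma moveItem_self (x : A → G → ℕ) (j : G) (src dst i : A) :
    moveItem x j src dst i j =
      if i = src then x i j - 1 else if i = dst then x i j + 1 else x i j := by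
  unfold moveItem removeItem addItem
  split_ifs <;> simp

lemma sum_moveItem (x : A → G → ℕ) {j : G} {src dst : A} (h : 1 ≤ x src j) (hne : src ≠ dst) :
    ∑ i, moveItem x j src dst i j = ∑ i, x i j := by
  have h1 : ∑ i, (moveItem x j src dst i j + if i = src then 1 else 0) =
      ∑ i, (x i j + if i = dst then 1 else 0) := by
    refine Finset.sum_congr rfl fun i _ => ?_
    rw [moveItem_self]
    by_cases h2 : i = src
    · subst h2
      simp [hne, Nat.sub_add_cancel h]
    · by_cases h3 : i = dst
      · subst h3
        simp [h2]
      · simp [h2, h3]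
  simpa [Finset.sum_add_distrib] using h1

lemma mul_eq_of_eq_div {a u p : ℝ≥0} (ha : 0 < a) (h : a = u / p) : a * p = u ∧ 0 < p := by
  have hp : p ≠ 0 := by
    rintro rfl
    rw [div_zero] at h
    exact ha.ne' h
  exact ⟨(eq_div_iff hp).1 h, pos_iff_ne_zero.2 hp⟩

/-- Tightness means that the moved copy is worth exactly `α * p` both to the agent losing it and to
the agent receiving it, so it may sit on either side of the price. -/
lemma IsInvariant.moveItem {x : A → G → ℕ} {p : G → ℝ≥0} {α : A → ℝ≥0}
    (hs : I.IsInvariant ⟨x, p, α⟩) {j : G} {src dst : A} (hne : src ≠ dst)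
    (hsrc : I.TightToAgent ⟨x, p, α⟩ j src) (hdst : I.TightToGood ⟨x, p, α⟩ dst j) :
    I.IsInvariant ⟨moveItem x j src dst, p, α⟩ where
  mbb_pos := hs.mbb_pos
  isAllocation j' := by
    rcases eq_or_ne j' j with rfl | h
    · exact (sum_moveItem x hsrc.1 hne).trans (hs.isAllocation j')
    · simp only [moveItem_of_ne x src dst _ h]
      exact hs.isAllocation j'
  utility_succ_le i j' := by
    rcases eq_or_ne j' j with rfl | h
    · simp only [moveItem_self]
      split_ifs with h1 h2
      · subst h1
        intro _
        have h3 := hsrc.1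
        simp only at h3
        rw [Nat.sub_add_cancel h3, (mul_eq_of_eq_div (hs.mbb_pos i) hsrc.2).1]
      · subst h2
        intro h3
        rw [(mul_eq_of_eq_div (hs.mbb_pos i) hdst.2).1]
        exact I.utility_anti i j' _ (by omega) h3
      · exact hs.utility_succ_le i j'
    · simp only [moveItem_of_ne x src dst _ h]
      exact hs.utility_succ_le i j'
  le_utility i j' := by
    rcases eq_or_ne j' j with rfl | h
    · simp only [moveItem_self]
      split_ifs with h1 h2
      · subst h1
        intro h3
        rw [(mul_eq_of_eq_div (hs.mbb_pos i) hsrc.2).1]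
        exact I.utility_le_of_le i j' h3 (Nat.sub_le _ _) (hs.isAllocation.le_copies i j')
      · subst h2
        intro _
        rw [(mul_eq_of_eq_div (hs.mbb_pos i) hdst.2).1]
      · exact hs.le_utility i j'
    · simp only [moveItem_of_ne x src dst _ h]
      exact hs.le_utility i j'

lemma IsInvariant.swaps {ε : ℝ≥0} {p : G → ℝ≥0} {α : A → ℝ≥0} {i : A} {a : ℕ → A} {g : ℕ → G}
    (h : ℕ) {x : A → G → ℕ} (hs : I.IsInvariant ⟨x, p, α⟩)
    (hgood : ∀ ℓ, ℓ < h → I.TightToGood ⟨x, p, α⟩ (a ℓ) (g (ℓ + 1)))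
    (hagent : ∀ ℓ, ℓ < h → I.TightToAgent ⟨x, p, α⟩ (g (ℓ + 1)) (a (ℓ + 1)))
    (ha : Set.InjOn a (Set.Icc 0 h)) (hg : Set.InjOn g (Set.Icc 1 h)) :
    I.IsInvariant ⟨I.swaps ε α i a g h x, p, α⟩ := by
  induction h generalizing x with
  | zero => exact hs
  | succ h ih =>
    unfold FairDivision.swaps
    split_ifs with hc
    swap
    · exact hs
    have hne : a (h + 1) ≠ a h := fun h1 => by
      have := ha (by simp) (by simp) h1
      omega
    -- The goods of the path are distinct, so a move leaves the multiplicities of the earlier goods,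
    -- and hence their tight edges, untouched.
    have hcol : ∀ ℓ, ℓ < h → ∀ k, _root_.moveItem x (g (h + 1)) (a (h + 1)) (a h) k (g (ℓ + 1)) =
        x k (g (ℓ + 1)) := fun ℓ hℓ k => moveItem_of_ne _ _ _ _ fun h1 => by
      have := hg (Set.mem_Icc.2 ⟨by omega, by omega⟩) (Set.mem_Icc.2 ⟨by omega, by omega⟩) h1
      omega
    refine ih (hs.moveItem hne (hagent h (by omega)) (hgood h (by omega))) ?_ ?_
      (ha.mono (Set.Icc_subset_Icc_right (by omega))) (hg.mono (Set.Icc_subset_Icc_right (by omega)))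
    · intro ℓ hℓ
      have h1 := hgood ℓ (by omega)
      simp only [TightToGood, hcol ℓ hℓ] at h1 ⊢
      exact h1
    · intro ℓ hℓ
      have h1 := hagent ℓ (by omega)
      simp only [TightToAgent, hcol ℓ hℓ] at h1 ⊢
      exact h1

/-! ### Price increases -/

lemma IsInvariant.one_le_beta1 {s : MarketState A G} (hs : I.IsInvariant s) (S : Set (A ⊕ G)) :
    1 ≤ I.beta1 s S := by
  refine le_iInf fun k => le_iInf fun j => le_iInf fun h => ?_
  have h1 := hs.utility_succ_le k j h.2.2
  have h2 := hs.mbb_pos k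
  -- For zero utility the denominator is `0`, even at price `0` since `0 / 0 = 0`, and the quotient
  -- is `∞`.
  rcases eq_or_ne (I.utility k j (s.alloc k j + 1)) 0 with h0 | h0
  · simp [h0, ENNReal.div_zero, h2.ne']
  · have hp : s.price j ≠ 0 := by
      intro hp
      rw [hp, mul_zero] at h1
      exact h0 (le_antisymm h1 zero_le)
    rw [← ENNReal.coe_div hp, ← ENNReal.coe_div (div_ne_zero h0 hp), ENNReal.one_le_coe_iff,
      one_le_div (by positivity), div_le_iff₀ (by positivity)]
    exact h1

lemma IsInvariant.one_le_beta2 {s : MarketState A G} (hs : I.IsInvariant s) {S : Set (A ⊕ G)}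
    (hS : ∀ j, .inr j ∈ S → 0 < s.price j) : 1 ≤ I.beta2 s S := by
  refine le_iInf fun k => le_iInf fun j => le_iInf fun h => ?_
  have h1 := hs.le_utility k j h.2.2
  have h2 := hs.mbb_pos k
  have hp := hS j h.2.1
  rw [← ENNReal.coe_div hp.ne', ← ENNReal.coe_div h2.ne', ENNReal.one_le_coe_iff,
      one_le_div h2, le_div_iff₀ hp]
  exact h1

lemma IsLeastSpending.one_le_beta4 {ε : ℝ≥0} {s : MarketState A G} {i : A}
    (hi : I.IsLeastSpending s (fun _ => True) i) (S : Set (A ⊕ G)) : 1 ≤ I.beta4 ε s i S := by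
  refine le_iInf fun h => le_iInf fun t => le_iInf fun ht => ?_
  obtain ⟨hh, -, h2⟩ := ht
  have h3 := hi.2.2 h trivial hh.2.1
  rw [ENNReal.one_le_coe_iff]
  by_contra! h4
  exact absurd (h3.trans_lt h2) (not_lt.2 (mul_le_of_le_one_left zero_le h4.le))

/-- A reachable good is entered by a tight edge; at price `0` that edge would give MBB-ratio `0`, as
`u / 0 = 0`. -/
lemma IsInvariant.price_pos_of_mem_reachable {s : MarketState A G} (hs : I.IsInvariant s) {i : A}
    {j : G} (hj : .inr j ∈ I.reachable s i) : 0 < s.price j := by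
  obtain h | ⟨v, -, h⟩ := Relation.ReflTransGen.cases_tail hj
  · cases h
  · rcases v with k | j'
    · exact (mul_eq_of_eq_div (hs.mbb_pos k) h.2).2
    · exact h.elim

lemma IsInvariant.raisePrices {s : MarketState A G} (hs : I.IsInvariant s) {S : Set (A ⊕ G)}
    (hS : ∀ j, .inr j ∈ S → 0 < s.price j) {b : ℝ≥0} (hb : 1 ≤ b) (hb1 : (b : ℝ≥0∞) ≤ I.beta1 s S)
    (hb2 : (b : ℝ≥0∞) ≤ I.beta2 s S) : I.IsInvariant (raisePrices s S b) := by
  have hb0 : 0 < b := one_pos.trans_le hb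
  refine ⟨fun k => ?_, hs.isAllocation, fun k j hkj => ?_, fun k j hkj => ?_⟩
  · have := hs.mbb_pos k
    simp only [FairDivision.raisePrices]
    split_ifs <;> positivity
  · have h1 := hs.utility_succ_le k j hkj
    have hm := hs.mbb_pos k
    simp only [FairDivision.raisePrices] at hkj ⊢
    -- With agent and good both in `S` the product `α * p` is unchanged. With only the agent in `S`
    -- it falls, which `beta1` limits; with only the good in `S` it rises, which limits only the
    -- upper bound below, through `beta2`.
    split_ifs with h2 h3 h3
    · rw [div_mul_eq_mul_div, ← mul_assoc, mul_div_cancel_right₀ _ hb0.ne']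
      exact h1
    · rcases eq_or_ne (I.utility k j (s.alloc k j + 1)) 0 with h0 | h0
      · rw [h0]; exact zero_le
      have hp : s.price j ≠ 0 := by
        intro hp
        rw [hp, mul_zero] at h1
        exact h0 (le_antisymm h1 zero_le)
      have h4 := hb1.trans (iInf_le_of_le k (iInf_le_of_le j (iInf_le _ ⟨h2, h3, hkj⟩)))
      rw [← ENNReal.coe_div hp, ← ENNReal.coe_div (div_ne_zero h0 hp), ENNReal.coe_le_coe,
        le_div_iff₀ (by positivity), ← mul_div_assoc, div_le_iff₀ (by positivity)] at h4
      rw [div_mul_eq_mul_div, le_div_iff₀ hb0, mul_comm]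
      exact h4
    · exact h1.trans (mul_le_mul_of_nonneg_left (le_mul_of_one_le_right zero_le hb) zero_le)
    · exact h1
  · have h1 := hs.le_utility k j hkj
    have hm := hs.mbb_pos k
    simp only [FairDivision.raisePrices] at hkj ⊢
    split_ifs with h2 h3 h3
    · rw [div_mul_eq_mul_div, ← mul_assoc, mul_div_cancel_right₀ _ hb0.ne']
      exact h1
    · exact (mul_le_mul_of_nonneg_right (div_le_self zero_le hb) zero_le).trans h1
    · have hp := hS j h3
      have h4 := hb2.trans (iInf_le_of_le k (iInf_le_of_le j (iInf_le _ ⟨h2, h3, hkj⟩)))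
      rw [← ENNReal.coe_div hp.ne', ← ENNReal.coe_div hm.ne', ENNReal.coe_le_coe,
        le_div_iff₀ hm, le_div_iff₀ hp] at h4
      convert h4 using 1
      ring
    · exact h1

/-- The invariant keeps `beta1` and `beta2` at least `1`, minimality of `i` does so for `beta4`, and
`beta3` enters only through `max 1`. -/
lemma PriceIncrease.exists_factor {ε : ℝ≥0} {s s' : MarketState A G} {i : A} (hs : I.IsInvariant s)
    (h : I.PriceIncrease ε s i s') : ∃ b : ℝ≥0, s' = FairDivision.raisePrices s (I.reachable s i) b ∧
      (b : ℝ≥0∞) = I.beta ε s i (I.reachable s i) ∧ 1 ≤ b := by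
  obtain ⟨-, hi, -, hb, hs'⟩ := h
  refine ⟨_, hs', ENNReal.coe_toNNReal hb, ?_⟩
  rw [← ENNReal.one_le_coe_iff, ENNReal.coe_toNNReal hb]
  exact le_min (le_min (hs.one_le_beta1 _)
    (hs.one_le_beta2 fun _ hj => hs.price_pos_of_mem_reachable hj))
    (le_min (le_max_left _ _) (hi.one_le_beta4 _))

lemma PriceIncrease.isInvariant {ε : ℝ≥0} {s s' : MarketState A G} {i : A} (hs : I.IsInvariant s)
    (h : I.PriceIncrease ε s i s') : I.IsInvariant s' := by
  obtain ⟨b, rfl, hb, hb1⟩ := h.exists_factor hs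
  exact hs.raisePrices (fun _ hj => hs.price_pos_of_mem_reachable hj) hb1
    (hb.trans_le ((min_le_left _ _).trans (min_le_left _ _)))
    (hb.trans_le ((min_le_left _ _).trans (min_le_right _ _)))

lemma Step.isInvariant {ε : ℝ≥0} {s s' : MarketState A G} (hs : I.IsInvariant s)
    (h : I.Step ε s s') : I.IsInvariant s' := by
  cases h with
  | swap i h a g _ _ hp =>
    exact IsInvariant.swaps h hs hp.1.tight_good hp.1.tight_agent hp.1.agents_distinct
      hp.1.goods_distinct
  | increase i _ h _ => exact h.isInvariant hs

/-! ### Tight paths -/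

/-- A simple path in the tight graph. -/
structure IsTightPath (I : FairDivision A G) (s : MarketState A G) (i : A) (h : ℕ) (a : ℕ → A)
    (g : ℕ → G) : Prop where
  start : a 0 = i
  tight_good : ∀ ℓ, ℓ < h → I.TightToGood s (a ℓ) (g (ℓ + 1))
  tight_agent : ∀ ℓ, ℓ < h → I.TightToAgent s (g (ℓ + 1)) (a (ℓ + 1))
  agents_distinct : Set.InjOn a (Set.Icc 0 h)
  goods_distinct : Set.InjOn g (Set.Icc 1 h)

variable {s : MarketState A G} {i : A} {h : ℕ} {a : ℕ → A} {g : ℕ → G}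

lemma IsTightPath.truncate (hp : I.IsTightPath s i h a g) {h' : ℕ} (hh : h' ≤ h) :
    I.IsTightPath s i h' a g where
  start := hp.start
  tight_good ℓ hℓ := hp.tight_good ℓ (by omega)
  tight_agent ℓ hℓ := hp.tight_agent ℓ (by omega)
  agents_distinct := hp.agents_distinct.mono (Set.Icc_subset_Icc_right hh)
  goods_distinct := hp.goods_distinct.mono (Set.Icc_subset_Icc_right hh)

lemma IsTightPath.append (hp : I.IsTightPath s i h a g) {j : G} {k : A}
    (hj : I.TightToGood s (a h) j) (hk : I.TightToAgent s j k) (hk' : ∀ t ≤ h, a t ≠ k)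
    (hj' : ∀ t, 1 ≤ t → t ≤ h → g t ≠ j) :
    I.IsTightPath s i (h + 1) (fun t => if t ≤ h then a t else k)
      (fun t => if t ≤ h then g t else j) where
  start := by simp [hp.start]
  tight_good ℓ hℓ := by
    rcases eq_or_ne ℓ h with rfl | hne
    · simpa using hj
    · have h1 : ℓ + 1 ≤ h := by omega
      simpa [h1, (Nat.le_succ ℓ).trans h1] using hp.tight_good ℓ h1
  tight_agent ℓ hℓ := by
    rcases eq_or_ne ℓ h with rfl | hne
    · simpa using hk
    · have h1 : ℓ + 1 ≤ h := by omega
      simpa [h1] using hp.tight_agent ℓ h1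
  agents_distinct t ht t' ht' heq := by
    simp only [Set.mem_Icc] at ht ht' heq
    split_ifs at heq with h1 h2 h2
    · exact hp.agents_distinct ⟨by omega, h1⟩ ⟨by omega, h2⟩ heq
    · exact absurd heq (hk' t h1)
    · exact absurd heq.symm (hk' t' h2)
    · omega
  goods_distinct t ht t' ht' heq := by
    simp only [Set.mem_Icc] at ht ht' heq
    split_ifs at heq with h1 h2 h2
    · exact hp.goods_distinct ⟨ht.1, h1⟩ ⟨ht'.1, h2⟩ heq
    · exact absurd heq (hj' t ht.1 h1)
    · exact absurd heq.symm (hj' t' ht'.1 h2)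
    · omega

/-- Loops are cut out: if `k` is already on the path, stop there; if `j` is, leave for `k` at the
first visit of `j`. -/
lemma IsTightPath.exists_extend (hp : I.IsTightPath s i h a g) {j : G} {k : A}
    (hj : I.TightToGood s (a h) j) (hk : I.TightToAgent s j k) :
    ∃ h' a' g', I.IsTightPath s i h' a' g' ∧ a' h' = k := by
  by_cases hka : ∃ t ≤ h, a t = k
  · obtain ⟨t, ht, rfl⟩ := hka
    exact ⟨t, a, g, hp.truncate ht, rfl⟩
  push Not at hka
  obtain ⟨h', hh, hj', hne⟩ : ∃ h' ≤ h, I.TightToGood s (a h') j ∧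
      ∀ t, 1 ≤ t → t ≤ h' → g t ≠ j := by
    by_cases hjg : ∃ t, 1 ≤ t ∧ t ≤ h ∧ g t = j
    · obtain ⟨t, ht1, ht, rfl⟩ := hjg
      obtain ⟨t, rfl⟩ : ∃ t', t = t' + 1 := ⟨t - 1, by omega⟩
      refine ⟨t, by omega, hp.tight_good t ht, fun t' h1 h2 heq => ?_⟩
      have := hp.goods_distinct ⟨h1, by omega⟩ ⟨ht1, ht⟩ heq
      omega
    · push Not at hjg
      exact ⟨h, le_rfl, hj, hjg⟩
  exact ⟨_, _, _, (hp.truncate hh).append hj' hk (fun t ht => hka t (ht.trans hh)) hne, by simp⟩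

lemma exists_isTightPath [Nonempty G] {k : A} (hk : .inl k ∈ I.reachable s i) :
    ∃ h a g, I.IsTightPath s i h a g ∧ a h = k := by
  let motive : A ⊕ G → Prop := fun v => match v with
    | .inl k => ∃ h a g, I.IsTightPath s i h a g ∧ a h = k
    | .inr j => ∃ h a g, I.IsTightPath s i h a g ∧ I.TightToGood s (a h) j
  suffices ∀ v, Relation.ReflTransGen (I.TightEdge s) (.inl i) v → motive v from this _ hk
  intro v hv
  induction hv with
  | refl =>
    exact ⟨0, fun _ => i, fun _ => Classical.arbitrary G,
      ⟨rfl, by simp, by simp, by simp, by simp⟩, rfl⟩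
  | @tail v v' _ hvv' ih =>
    rcases v with k | j <;> rcases v' with k' | j'
    · exact hvv'.elim
    · obtain ⟨h, a, g, hp, rfl⟩ := ih
      exact ⟨h, a, g, hp, hvv'⟩
    · obtain ⟨h, a, g, hp, hj⟩ := ih
      exact hp.exists_extend hj hvv'
    · exact hvv'.elim

/-- Without an improving path, the agents in the tight component are not envied. -/
lemma exists_worth_removeItem_le_of_mem_reachable {ε : ℝ≥0}
    (hno : ¬ ∃ h a g, I.IsImprovingPath ε s i h a g) {k : A} (hk : .inl k ∈ I.reachable s i)
    (hki : k ≠ i) (hne : ∃ j, 1 ≤ s.alloc k j) : ∃ j, 1 ≤ s.alloc k j ∧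
      I.worth s.mbb k (removeItem (s.alloc k) j) ≤ (1 + ε) * I.worth s.mbb i (s.alloc i) := by
  classical
  by_contra! hbad
  have : Nonempty G := ⟨hne.choose⟩
  obtain ⟨h, a, g, hp, rfl⟩ := exists_isTightPath hk
  have hex : ∃ ℓ, 1 ≤ ℓ ∧ ℓ ≤ h ∧ (1 + ε) * I.worth s.mbb i (s.alloc i) <
      I.worth s.mbb (a ℓ) (removeItem (s.alloc (a ℓ)) (g ℓ)) := by
    rcases h with _ | h
    · exact absurd hp.start hki
    · exact ⟨h + 1, by omega, le_rfl, hbad _ (hp.tight_agent h (by omega)).1⟩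
  -- Truncating the tight path at the first agent violating the bound yields an improving path.
  obtain ⟨h1, h2, h3⟩ := Nat.find_spec hex
  have hq := hp.truncate h2
  refine hno ⟨_, a, g, hq.start, h1, hq.tight_good, hq.tight_agent, hq.agents_distinct,
    hq.goods_distinct, h3, fun ℓ hℓ hlt => ?_⟩
  by_contra! h4
  exact Nat.find_min hex hlt ⟨hℓ, by omega, h4⟩

/-! ### Envy-freeness of the returned allocation. -/

lemma exists_worth_eq_minAfterRemoval {k : A} (hne : ∃ j, 1 ≤ s.alloc k j) :
    ∃ j, 1 ≤ s.alloc k j ∧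
      I.worth s.mbb k (removeItem (s.alloc k) j) = I.minAfterRemoval s k := by
  have h : (Finset.univ.filter fun j => 1 ≤ s.alloc k j).Nonempty := by
    obtain ⟨j, hj⟩ := hne
    exact ⟨j, by simpa using hj⟩
  obtain ⟨j, hj, heq⟩ := Finset.exists_mem_eq_inf' h
    fun j => I.worth s.mbb k (removeItem (s.alloc k) j)
  refine ⟨j, by simpa using hj, ?_⟩
  rw [minAfterRemoval, dif_pos h, heq]

lemma minAfterRemoval_le_of_beta3_le {ε b : ℝ≥0} {S : Set (A ⊕ G)}
    (hb : I.beta3 ε s i S ≤ b) {k : A} (hk : .inl k ∉ S) :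
    I.minAfterRemoval s k ≤ (1 + ε) ^ 2 * I.worth s.mbb i (s.alloc i) * b := by
  rw [beta3] at hb
  have h1 : (I.minAfterRemoval s k : ℝ≥0∞) ≤
      ⨆ (k : A) (_ : .inl k ∉ S), (I.minAfterRemoval s k : ℝ≥0∞) :=
    le_iSup₂_of_le k hk le_rfl
  generalize (1 + ε) ^ 2 * I.worth s.mbb i (s.alloc i) = X at hb ⊢
  have h2 := (mul_le_mul_right h1 _).trans hb
  -- If `X = 0`, the factor `1 / X` is `∞`, and finiteness of `b` forces the minimum after removal
  -- to vanish.
  rcases eq_or_ne X 0 with rfl | hX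
  · rw [ENNReal.coe_zero, one_div, ENNReal.inv_zero] at h2
    by_contra! h3
    rw [zero_mul] at h3
    rw [ENNReal.top_mul (by simpa using h3.ne')] at h2
    exact ENNReal.coe_ne_top (top_le_iff.1 h2)
  · rw [one_div, ← ENNReal.coe_inv hX, ← ENNReal.coe_mul, ENNReal.coe_le_coe,
      inv_mul_le_iff₀ (by positivity)] at h2
    exact h2

lemma worth_raisePrices_of_mem {S : Set (A ⊕ G)} {k : A} (hk : .inl k ∈ S) (b : ℝ≥0) (x : G → ℕ) :
    I.worth (raisePrices s S b).mbb k x = b * I.worth s.mbb k x := by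
  simp only [worth, raisePrices, if_pos hk, div_div_eq_mul_div]
  ring

lemma worth_raisePrices_of_notMem {S : Set (A ⊕ G)} {k : A} (hk : .inl k ∉ S) (b : ℝ≥0)
    (x : G → ℕ) : I.worth (raisePrices s S b).mbb k x = I.worth s.mbb k x := by
  simp only [worth, raisePrices, if_neg hk]

/-- After a price increase, the chosen agent is almost least spending. -/
lemma worth_raisePrices_le {ε b : ℝ≥0} (hε : 0 < ε) {S : Set (A ⊕ G)}
    (hi : I.IsLeastSpending s (fun _ => True) i)
    (hb : (b : ℝ≥0∞) ≤ I.beta4 ε s i S) {h : A} (hh : I.Uncapped s h) :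
    b * I.worth s.mbb i (s.alloc i) ≤
      (1 + ε) * I.worth (raisePrices s S b).mbb h (s.alloc h) := by
  by_cases hhS : .inl h ∈ S
  · rw [worth_raisePrices_of_mem hhS]
    refine (mul_le_mul_of_nonneg_left (hi.2.2 h trivial hh) zero_le).trans ?_
    exact le_mul_of_one_le_left zero_le le_self_add
  rw [worth_raisePrices_of_notMem hhS]
  obtain ⟨h₀, hh₀⟩ := I.exists_isLeastSpending s (fun k => .inl k ∉ S) ⟨h, hhS, hh⟩
  rcases eq_or_ne (I.worth s.mbb i (s.alloc i)) 0 with h0 | h0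
  · rw [h0, mul_zero]; exact zero_le
  have hpos : 0 < I.worth s.mbb i (s.alloc i) := pos_iff_ne_zero.2 h0
  have h1 := hi.2.2 h₀ trivial hh₀.2.1
  -- Here `r ^ t ≤ P_h₀ / P_i < r ^ (t + 1)`, so `t + 1` is the exponent admitted in `beta4`.
  obtain ⟨t, ht, ht'⟩ := exists_mem_Ico_zpow (y := 1 + ε) (div_pos (hpos.trans_le h1) hpos)
    (lt_add_of_pos_right 1 hε)
  rw [le_div_iff₀ hpos] at ht
  rw [div_lt_iff₀ hpos] at ht'
  have h2 : (b : ℝ≥0∞) ≤ (((1 + ε) ^ (t + 1) : ℝ≥0) : ℝ≥0∞) :=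
    hb.trans (iInf_le_of_le h₀ (iInf_le_of_le (t + 1)
      (iInf_le _ ⟨hh₀, by rwa [add_sub_cancel_right], ht'⟩)))
  rw [ENNReal.coe_le_coe, zpow_add_one₀ (by positivity)] at h2
  calc b * I.worth s.mbb i (s.alloc i) ≤
        (1 + ε) ^ t * (1 + ε) * I.worth s.mbb i (s.alloc i) := by gcongr
    _ = (1 + ε) * ((1 + ε) ^ t * I.worth s.mbb i (s.alloc i)) := by ring
    _ ≤ (1 + ε) * I.worth s.mbb h (s.alloc h) := by
        gcongr
        exact ht.trans (hh₀.2.2 h hhS hh)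

lemma Halt.isInvariant_and_isPEF1 {ε : ℝ≥0} (hε : 0 < ε) (hε' : ε ≤ 1 / 4) {s' : MarketState A G}
    (hs : I.IsInvariant s) (h : I.Halt ε s s') : I.IsInvariant s' ∧ I.IsPEF1 (4 * ε) s' := by
  cases h with
  | done hd =>
    refine ⟨hs, fun i hi k hk hE => hd i hi k hk ⟨hE.1, fun j hj => lt_of_le_of_lt ?_ (hE.2 j hj)⟩⟩
    gcongr
    exact le_mul_of_one_le_left zero_le (by norm_num)
  | increase i _ hinc hbr =>
    refine ⟨hinc.isInvariant hs, ?_⟩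
    obtain ⟨b, rfl, hb, hb1⟩ := hinc.exists_factor hs
    obtain ⟨-, hi, hno, -, -⟩ := hinc
    set S := I.reachable s i with hS
    -- When the break test succeeds, neither `beta1`, `beta2` nor `beta4` pushes the factor below
    -- `beta3`.
    have hb3 : I.beta3 ε s i S ≤ b := by
      rw [hb]
      unfold BreakTest at hbr
      exact le_min (hbr.trans (min_le_left _ _))
        (le_min (le_max_right _ _) (hbr.trans (min_le_right _ _)))
    have hb4 : (b : ℝ≥0∞) ≤ I.beta4 ε s i S :=
      hb.trans_le ((min_le_right _ _).trans (min_le_right _ _))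
    have hr : (1 : ℝ≥0) ≤ 1 + ε := le_self_add
    have hbound : ∀ k, (∃ j, 1 ≤ s.alloc k j) → ∃ j, 1 ≤ s.alloc k j ∧
        I.worth (FairDivision.raisePrices s S b).mbb k (removeItem (s.alloc k) j) ≤
          (1 + ε) ^ 2 * (b * I.worth s.mbb i (s.alloc i)) := by
      intro k hne
      by_cases hkS : .inl k ∈ S
      · have h1 : ∃ j, 1 ≤ s.alloc k j ∧ I.worth s.mbb k (removeItem (s.alloc k) j) ≤
            (1 + ε) * I.worth s.mbb i (s.alloc i) := by
          rcases eq_or_ne k i with rfl | hki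
          · obtain ⟨j, hj⟩ := hne
            exact ⟨j, hj, (worth_removeItem_le _ _ _ _).trans (le_mul_of_one_le_left zero_le hr)⟩
          · exact exists_worth_removeItem_le_of_mem_reachable hno hkS hki hne
        obtain ⟨j, hj, h1⟩ := h1
        refine ⟨j, hj, ?_⟩
        rw [worth_raisePrices_of_mem hkS]
        calc _ ≤ b * ((1 + ε) * I.worth s.mbb i (s.alloc i)) := by gcongr
          _ ≤ (1 + ε) * (b * ((1 + ε) * I.worth s.mbb i (s.alloc i))) :=
            le_mul_of_one_le_left zero_le hr
          _ = _ := by ring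
      · obtain ⟨j, hj, h1⟩ := exists_worth_eq_minAfterRemoval (I := I) hne
        refine ⟨j, hj, ?_⟩
        rw [worth_raisePrices_of_notMem hkS, h1]
        refine (minAfterRemoval_le_of_beta3_le hb3 hkS).trans_eq ?_
        ring
    intro h hh k _ hE
    obtain ⟨j, hj, h1⟩ := hbound k hE.1
    refine absurd (hE.2 j hj) (not_lt.2 (h1.trans ?_))
    have h2 := worth_raisePrices_le hε hi hb4 hh
    -- Two factors `1 + ε` come from `beta3` and one from the rounding in `beta4`; the inequality
    -- needs `3 ε + ε ^ 2 ≤ 1`.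
    have h3 : (1 + ε) ^ 3 ≤ 1 + 4 * ε := by
      rw [← NNReal.coe_le_coe] at hε' ⊢
      push_cast at hε' ⊢
      have h4 := ε.coe_nonneg
      nlinarith [mul_nonneg h4 h4, mul_nonneg h4 (sub_nonneg.2 hε')]
    calc (1 + ε) ^ 2 * (b * I.worth s.mbb i (s.alloc i)) ≤
          (1 + ε) ^ 2 * ((1 + ε) * I.worth (FairDivision.raisePrices s S b).mbb h (s.alloc h)) := by
          gcongr
      _ = (1 + ε) ^ 3 * I.worth (FairDivision.raisePrices s S b).mbb h (s.alloc h) := by ring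
      _ ≤ _ := by gcongr; rfl

/-! ### Capping single utilities preserves Nash social welfare. -/

/-- If some term reaches `c`, both sides equal `c`; otherwise the inner minima change nothing. -/
lemma min_cap_sum_min {ι : Type*} (S : Finset ι) (c : ℝ≥0) (f : ι → ℝ≥0) :
    min c (∑ i ∈ S, min c (f i)) = min c (∑ i ∈ S, f i) := by
  classical
  by_cases h : ∃ i ∈ S, c ≤ f i
  · obtain ⟨i, hi, hc⟩ := h
    have h1 : c ≤ ∑ i ∈ S, min c (f i) := by
      refine le_trans ?_ (Finset.single_le_sum (f := fun i => min c (f i)) (fun _ _ => zero_le) hi)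
      exact le_min le_rfl hc
    rw [min_eq_left h1, min_eq_left (h1.trans (Finset.sum_le_sum fun i _ => min_le_right _ _))]
  · push Not at h
    rw [Finset.sum_congr rfl fun i hi => min_eq_right (h i hi).le]

lemma nsw_capUtilities (I : FairDivision A G) (x : A → G → ℕ) : I.capUtilities.nsw x = I.nsw x := by
  have h : ∀ i, min (I.capUtilities.cap i) (I.capUtilities.bundleUtility i (x i)) =
      min (I.cap i) (I.bundleUtility i (x i)) := by
    intro i
    simp only [bundleUtility, capUtilities, Finset.sum_sigma']
    exact min_cap_sum_min _ _ _
  simp only [nsw, h]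

end FairDivision

theorem mainTheorem1 {A G : Type*} [Fintype A] [DecidableEq A] [Fintype G] [DecidableEq G] :
    (∀ (ε : ℝ≥0), 0 < ε → ε ≤ 1 / 4 →
      ∀ I : FairDivision A G, I.IsRounded (1 + ε) →
      ∀ xalg : A → G → ℕ, I.AlgorithmReturns ε xalg →
        I.IsAllocation xalg ∧
        ∀ xopt : A → G → ℕ, I.IsOptimal xopt →
          I.nsw xopt ≤ Real.exp (Real.exp (-1 / (1 + 4 * (ε : ℝ)))) * I.nsw xalg) ∧
    Tendsto (fun ε : ℝ => Real.exp (Real.exp (-1 / (1 + 4 * ε)))) (𝓝[>] 0)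
      (𝓝 (Real.exp (1 / Real.exp 1))) := by
  constructor
  · rintro ε hε hε' I hI _ ⟨s₀, s, s', hinit, hsteps, hhalt, rfl⟩
    have hs : I.capUtilities.IsInvariant s := by
      clear hhalt
      induction hsteps with
      | refl => exact hinit.isInvariant
      | tail _ hstep ih => exact hstep.isInvariant ih
    obtain ⟨hs', hef⟩ := hhalt.isInvariant_and_isPEF1 hε hε' hs
    refine ⟨hs'.isAllocation, fun xopt hopt => ?_⟩
    have hpos : ∀ i, 0 < I.capUtilities.cap i := fun i => by
      obtain ⟨z, hz⟩ := hI.2 i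
      change 0 < I.cap i
      rw [hz]
      positivity
    have hγ : 4 * ε ≤ 1 := by
      calc 4 * ε ≤ 4 * (1 / 4) := by gcongr
        _ = 1 := by norm_num
    have h := hs'.nsw_le (fun i j ℓ => min_le_left _ _) hpos hγ hef (y := xopt) hopt.1
    rw [I.nsw_capUtilities, I.nsw_capUtilities] at h
    exact_mod_cast h
  · have h : ContinuousAt (fun ε : ℝ => Real.exp (Real.exp (-1 / (1 + 4 * ε)))) 0 := by
      refine ContinuousAt.rexp (ContinuousAt.rexp (ContinuousAt.div₀ ?_ ?_ (by norm_num)))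
      · fun_prop
      · fun_prop
    have h0 : Real.exp (Real.exp (-1 / (1 + 4 * (0 : ℝ)))) = Real.exp (1 / Real.exp 1) := by
      rw [mul_zero, add_zero, div_one, Real.exp_neg, one_div]
    rw [← h0]
    exact h.tendsto.mono_left nhdsWithin_le_nhds
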